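/- Let $n\ge 0$ be an integer and let $S$ be a uniformly random subset of $\{0,1\}^n$ (each of the $2^{2^n}$ subsets having the same probability). An $r$-dimensional subcube of $\{0,1\}^n$ is a set of the form $\{x\in\{0,1\}^n : x_i=\alpha_i \text{ for all } i\notin J\}$, where $J\subseteq\{1,\dots,n\}$ has exactly $r$ elements and $\alpha_i\in\{0,1\}$ for $i\notin J$. Let $X_r=X_r(S)$ be the number of $r$-dimensional subcubes $C$ of $\{0,1\}^n$ with $C\subseteq S$, and let $\mu_r(n)=\mathbb{E}[X_r]$. Then $$\mathbb{E}\big[(X_2-\mu_2(n))^3\big]=\frac{2^{n}\,n(n-1)}{32768}\left(9n^{4}+6n^{3}+21n^{2}-16n-34\right),$$ $$\begin{aligned}\mathbb{E}\big[(X_2-\mu_2(n))^4\big]=\frac{2^{n}\,n(n-1)}{4194304}\big(&12n^{6}2^{n}+12n^{5}2^{n}+520n^{6}+24n^{4}2^{n}-24n^{5}-12n^{3}2^{n}+1272n^{4}\\&-9n^{2}2^{n}-840n^{3}-27n\,2^{n}-5232n^{2}-2768n+240\big),\end{aligned}$$ $$\mathbb{E}\big[(X_3-\mu_3(n))^3\big]=\frac{2^{n}\,n(n-1)(n-2)}{2415919104}\left(14n^{6}+24n^{5}+479n^{4}+2046n^{3}+6779n^{2}+15444n-23112\right).$$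 -/

import Mathlib

/-- The vertex set `{0,1}^n` of the discrete unit cube. -/
abbrev Cube (n : ℕ) : Type := Fin n → Bool

/-- The subcube through `a` whose set of free coordinates is `J`: all the points that agree
with `a` in every coordinate outside `J`. -/
def subcube {n : ℕ} (J : Finset (Fin n)) (a : Cube n) : Finset (Cube n) :=
  Finset.univ.filter fun x => ∀ i, i ∉ J → x i = a i

/-- The finite set of all `r`-dimensional subcubes of `{0,1}^n`, as sets of vertices
(empty if `r > n`). -/
def subcubes (n r : ℕ) : Finset (Finset (Cube n)) :=
  Finset.univ.filter fun C => ∃ (J : Finset (Fin n)) (a : Cube n), J.card = r ∧ C = subcube J a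

/-- `X_r(S)`: the number of `r`-dimensional subcubes of `{0,1}^n` contained in `S`. -/
def subcubeCount (n r : ℕ) (S : Finset (Cube n)) : ℕ :=
  ((subcubes n r).filter fun C => C ⊆ S).card

/-- The law of a uniformly random subset of `{0,1}^n`. -/
noncomputable def uniformSubset (n : ℕ) : MeasureTheory.Measure (Finset (Cube n)) :=
  ProbabilityTheory.uniformOn Set.univ

/-- The `k`-th moment about the mean of `X_r`, `E[(X_r - E[X_r])^k]`, for a uniformly random
subset of `{0,1}^n`. -/
noncomputable def subcubeCentralMoment (n r k : ℕ) : ℝ :=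
  ProbabilityTheory.centralMoment (fun S => (subcubeCount n r S : ℝ)) k (uniformSubset n)

/-!
A cluster expansion. The `k`-th central moment is, up to a power of two, the sum over `k`-tuples of
subcubes `C i` of the joint moment of the centered indicators of the events `C i ⊆ S`, which
expands as `∑ T, (-1) ^ #Tᶜ * 2 ^ overlap C T`. By inclusion–exclusion the overlap depends only on
the sets of free coordinates and on the graph of the pairs of subcubes that intersect. Möbius
inversion over the subgraphs `G` of this graph cancels every `G` with an isolated vertex, and the
remaining terms depend on the values of the fixed coordinates only through the condition that the
edges of `G` are intersecting pairs. This condition can be checked one coordinate at a time, so the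
sum over the values is a product of column counts.

What is left is a sum over the incidence matrices of `n` coordinates and `k` cubes, that is, over
words of length `n` in the subsets of the index set. A coordinate that is fixed in all the cubes
contributes a factor `B = 2 ^ c`, where `c` is the number of connected components of `G`, and at
most `k * r` coordinates are free in some cube. Hence the moment is a combination of the terms
`B ^ (n - m) * n.choose m` with coefficients that do not depend on `n`. For `k = 3` a graph without
isolated vertices is connected; for `k = 4` the perfect matchings are disconnected and produce the
terms in `4 ^ n`.
-/

open Finset
open scoped BigOperators

theorem integral_uniformOn_univ {Ω : Type*} [Fintype Ω] [MeasurableSpace Ω]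
    [MeasurableSingletonClass Ω] (f : Ω → ℝ) :
    ∫ ω, f ω ∂(ProbabilityTheory.uniformOn (Set.univ : Set Ω)) = 𝔼 ω, f ω := by
  rw [MeasureTheory.integral_fintype .of_finite, Fintype.expect_eq_sum_div_card, sum_div]
  simp [MeasureTheory.Measure.real, ProbabilityTheory.uniformOn_univ, div_eq_inv_mul]

theorem centralMoment_uniformOn_univ {Ω : Type*} [Fintype Ω] [MeasurableSpace Ω]
    [MeasurableSingletonClass Ω] (X : Ω → ℝ) (k : ℕ) :
    ProbabilityTheory.centralMoment X k (ProbabilityTheory.uniformOn Set.univ) =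
      𝔼 ω, (X ω - 𝔼 ω, X ω) ^ k := by
  simp only [ProbabilityTheory.centralMoment, Pi.pow_apply, Pi.sub_apply, integral_uniformOn_univ]

section RandomSubset

variable {α : Type*} [DecidableEq α]

/-- The indicator of the event `A ⊆ S`, rescaled to have mean one under a uniformly random `S`,
minus that mean. -/
def centeredIndicator (A S : Finset α) : ℝ := 2 ^ #A * (if A ⊆ S then 1 else 0) - 1

/-- The total size of the sets `A i`, `i ∈ T`, in excess of the size of their union. -/
def overlap {ι : Type*} (A : ι → Finset α) (T : Finset ι) : ℕ :=
  ∑ i ∈ T, #(A i) - #(T.biUnion A)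

variable [Fintype α]

theorem expect_indicator_subset (A : Finset α) :
    𝔼 S : Finset α, (if A ⊆ S then 1 else 0 : ℝ) = (2 ^ #A)⁻¹ := by
  have card_supersets : #{S : Finset α | A ⊆ S} = 2 ^ (Fintype.card α - #A) := by
    rw [← card_univ, ← card_Icc_finset (subset_univ A)]
    congr 1
    ext S
    simp only [mem_filter_univ, mem_Icc, subset_univ, and_true]
  rw [Fintype.expect_eq_sum_div_card, sum_boole, card_supersets, Fintype.card_finset,
    Nat.cast_pow, Nat.cast_pow, Nat.cast_ofNat, pow_sub₀ _ two_ne_zero (card_le_univ A)]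
  field_simp

theorem expect_prod_rescaled_indicator {ι : Type*} (A : ι → Finset α) (T : Finset ι) :
    𝔼 S : Finset α, ∏ i ∈ T, (2 ^ #(A i) * (if A i ⊆ S then 1 else 0) : ℝ) = 2 ^ overlap A T := by
  have prod_eq (S : Finset α) : ∏ i ∈ T, (2 ^ #(A i) * (if A i ⊆ S then 1 else 0) : ℝ) =
      2 ^ (∑ i ∈ T, #(A i)) * (if T.biUnion A ⊆ S then 1 else 0) := by
    rw [prod_mul_distrib, prod_pow_eq_pow_sum, prod_boole]
    simp only [biUnion_subset]
  simp only [prod_eq]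
  rw [← mul_expect, expect_indicator_subset, overlap, pow_sub₀ _ two_ne_zero card_biUnion_le]

theorem expect_prod_centeredIndicator {ι : Type*} [Fintype ι] [DecidableEq ι]
    (A : ι → Finset α) :
    𝔼 S, ∏ i, centeredIndicator (A i) S =
      ∑ T : Finset ι, (-1) ^ #Tᶜ * (2 : ℝ) ^ overlap A T := by
  simp only [centeredIndicator, sub_eq_add_neg _ (1 : ℝ), Fintype.prod_add, prod_const,
    expect_sum_comm, ← expect_mul, expect_prod_rescaled_indicator]
  exact sum_congr rfl fun T _ => mul_comm _ _

theorem overlap_eq_sum_card_inf {ι : Type*} (A : ι → Finset α) (T : Finset ι) :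
    (overlap A T : ℤ) = ∑ M ∈ T.powerset with 2 ≤ #M, (-1) ^ #M * (#(M.inf A) : ℤ) := by
  classical
  have small_sets : T.powerset.filter (¬ 2 ≤ #·) = insert ∅ (T.image singleton) := by
    ext M
    simp only [mem_filter, mem_powerset, not_le, Nat.lt_succ_iff, Nat.le_one_iff_eq_zero_or_eq_one,
      card_eq_zero, card_eq_one, mem_insert, mem_image]
    constructor
    · rintro ⟨hM, rfl | ⟨i, rfl⟩⟩
      · exact .inl rfl
      · exact .inr ⟨i, singleton_subset_iff.1 hM, rfl⟩
    · rintro (rfl | ⟨i, hi, rfl⟩)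
      · exact ⟨empty_subset T, .inl rfl⟩
      · exact ⟨singleton_subset_iff.2 hi, .inr ⟨i, rfl⟩⟩
  have compl_biUnion : (T.biUnion A)ᶜ = T.inf fun i => (A i)ᶜ := by
    rw [← sup_eq_biUnion, Finset.compl_sup]
  have incl_excl := inclusion_exclusion_card_inf_compl T A
  rw [← sum_filter_add_sum_filter_not _ (2 ≤ #·), small_sets,
    sum_insert (by simp), sum_image (by simp), ← compl_biUnion, card_compl,
    Nat.cast_sub (card_le_univ _)] at incl_excl
  simp only [card_empty, pow_zero, inf_empty, top_eq_univ, card_univ, one_mul, card_singleton,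
    pow_one, inf_singleton, neg_mul, sum_neg_distrib] at incl_excl
  rw [overlap, Nat.cast_sub card_biUnion_le, Nat.cast_sum]
  linarith

end RandomSubset

/-- Evaluating a bounded quantifier by counting counterexamples lets the kernel decide it much
faster than the recursive instance of the library. -/
local instance fastDecidableBAll {α : Type*} {s : Finset α} {p : α → Prop} [DecidablePred p] :
    Decidable (∀ a ∈ s, p a) :=
  decidable_of_iff (#{a ∈ s | ¬ p a} = 0)
    (by simp only [card_eq_zero, filter_eq_empty_iff, not_not])

section Subcube

variable {n : ℕ} {ι : Type*}

theorem mem_subcube {J : Finset (Fin n)} {a x : Cube n} :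
    x ∈ subcube J a ↔ ∀ j, j ∉ J → x j = a j := mem_filter_univ _

theorem card_subcube (J : Finset (Fin n)) (a : Cube n) : #(subcube J a) = 2 ^ #J := by
  have subcube_eq_pi :
      subcube J a = Fintype.piFinset fun j => if j ∈ J then univ else {a j} := by
    ext x
    simp only [mem_subcube, Fintype.mem_piFinset]
    refine forall_congr' fun j => ?_
    by_cases hj : j ∈ J <;> simp [hj]
  simp only [subcube_eq_pi, Fintype.card_piFinset, apply_ite card, card_univ, Fintype.card_bool,
    card_singleton, prod_ite_mem, univ_inter, prod_const]

/-- The subcubes `subcube (J i) (a i)`, `i ∈ M`, pairwise intersect: no two of them fix a common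
coordinate to different values. -/
def IsCompatible (J : ι → Finset (Fin n)) (a : ι → Cube n) (M : Finset ι) : Prop :=
  ∀ i ∈ M, ∀ i' ∈ M, ∀ j, j ∉ J i → j ∉ J i' → a i j = a i' j

instance (J : ι → Finset (Fin n)) (a : ι → Cube n) : DecidablePred (IsCompatible J a) := fun M =>
  inferInstanceAs (Decidable (∀ i ∈ M, ∀ i' ∈ M, ∀ j, j ∉ J i → j ∉ J i' → a i j = a i' j))

theorem IsCompatible.exists_inf_subcube_eq {J : ι → Finset (Fin n)} {a : ι → Cube n}
    {M : Finset ι} (h : IsCompatible J a M) :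
    ∃ b, M.inf (fun i => subcube (J i) (a i)) = subcube {j | ∀ i ∈ M, j ∈ J i} b := by
  classical
  refine ⟨fun j => if hj : ∃ i ∈ M, j ∉ J i then a hj.choose j else false, ?_⟩
  ext x
  simp only [mem_inf, mem_subcube, mem_filter_univ]
  constructor
  · intro hx j hj
    have fixed : ∃ i ∈ M, j ∉ J i := by simpa only [not_forall, exists_prop] using hj
    rw [dif_pos fixed]
    exact hx _ fixed.choose_spec.1 j fixed.choose_spec.2
  · intro hx i hi j hj
    have fixed : ∃ i ∈ M, j ∉ J i := ⟨i, hi, hj⟩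
    rw [hx j fun hall => hj (hall i hi), dif_pos fixed]
    exact h _ fixed.choose_spec.1 i hi j fixed.choose_spec.2 hj

theorem card_inf_subcube (J : ι → Finset (Fin n)) (a : ι → Cube n) (M : Finset ι) :
    #(M.inf fun i => subcube (J i) (a i)) =
      if IsCompatible J a M then 2 ^ #{j | ∀ i ∈ M, j ∈ J i} else 0 := by
  split_ifs with h
  · obtain ⟨b, hb⟩ := h.exists_inf_subcube_eq
    rw [hb, card_subcube]
  · rw [card_eq_zero, eq_empty_iff_forall_notMem]
    refine fun x hx => h fun i hi i' hi' j hj hj' => ?_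
    rw [← mem_subcube.1 (mem_inf.1 hx i hi) j hj, mem_subcube.1 (mem_inf.1 hx i' hi') j hj']

theorem isCompatible_iff_forall_pair {J : ι → Finset (Fin n)} {a : ι → Cube n} {M : Finset ι} :
    IsCompatible J a M ↔ ∀ e ∈ M.powersetCard 2, IsCompatible J a e := by
  classical
  refine ⟨fun h e he i hi i' hi' => ?_, fun h i hi i' hi' j hj hj' => ?_⟩
  · exact h i ((mem_powersetCard.1 he).1 hi) i' ((mem_powersetCard.1 he).1 hi')
  · obtain rfl | hne := eq_or_ne i i'
    · rfl
    · exact h {i, i'} (mem_powersetCard.2 ⟨by grind, card_pair hne⟩) i (by simp) i' (by simp)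
        j hj hj'

end Subcube

section Mobius

variable {α : Type*}

/-- The Möbius transform of `f` on the Boolean lattice of finite subsets of `α`. -/
def mobiusTransform (f : Finset α → ℤ) (G : Finset α) : ℤ :=
  ∑ H ∈ G.powerset, (-1) ^ (#G - #H) * f H

theorem mobiusTransform_insert [DecidableEq α] (f : Finset α → ℤ) {x : α} {G : Finset α}
    (hx : x ∉ G) :
    mobiusTransform f (insert x G) =
      mobiusTransform (fun H => f (insert x H)) G - mobiusTransform f G := by
  have card_insert_sub {H : Finset α} (hH : H ∈ G.powerset) : #(insert x G) - #H = #G - #H + 1 := by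
    rw [card_insert_of_notMem hx, Nat.succ_sub (card_le_card (mem_powerset.1 hH))]
  have card_insert_sub_insert {H : Finset α} (hH : H ∈ G.powerset) :
      #(insert x G) - #(insert x H) = #G - #H := by
    rw [card_insert_of_notMem hx, card_insert_of_notMem fun h => hx (mem_powerset.1 hH h),
      Nat.add_sub_add_right]
  rw [mobiusTransform, sum_powerset_insert hx, add_comm, sub_eq_add_neg, mobiusTransform,
    mobiusTransform, ← sum_neg_distrib]
  congr 1 <;> refine sum_congr rfl fun H hH => ?_
  · rw [card_insert_sub_insert hH]
  · rw [card_insert_sub hH, pow_succ, mul_neg_one, neg_mul]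

theorem sum_powerset_mobiusTransform (f : Finset α → ℤ) (E : Finset α) :
    ∑ G ∈ E.powerset, mobiusTransform f G = f E := by
  classical
  induction E using Finset.induction_on generalizing f with
  | empty => simp [mobiusTransform]
  | insert x E hx ih =>
    rw [sum_powerset_insert hx, sum_congr rfl fun G hG =>
      mobiusTransform_insert f fun h => hx (mem_powerset.1 hG h), sum_sub_distrib, ih, ih]
    ring

variable [DecidableEq α] [Fintype α]

theorem sum_neg_one_pow_card_compl_of_subset (V : Finset α) :
    ∑ T with V ⊆ T, (-1 : ℤ) ^ #Tᶜ = if V = univ then 1 else 0 := by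
  simp only [← compl_eq_empty_iff]
  rw [← sum_powerset_neg_one_pow_card]
  refine sum_nbij' compl compl ?_ ?_ ?_ ?_ ?_ <;> simp [subset_compl_comm]

theorem sum_neg_one_pow_card_compl_mul_filter_subset (f : Finset (Finset α) → ℤ)
    (E : Finset (Finset α)) :
    ∑ T : Finset α, (-1) ^ #Tᶜ * f {e ∈ E | e ⊆ T} =
      ∑ G ∈ E.powerset with G.sup id = univ, mobiusTransform f G := by
  have expand (T : Finset α) : f {e ∈ E | e ⊆ T} =
      ∑ G ∈ E.powerset, if G.sup id ⊆ T then mobiusTransform f G else 0 := by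
    rw [← sum_filter, ← sum_powerset_mobiusTransform f]
    refine sum_congr (ext fun G => ?_) fun _ _ => rfl
    simp only [mem_powerset, subset_iff, mem_filter, mem_sup, id]
    grind
  calc ∑ T : Finset α, (-1) ^ #Tᶜ * f {e ∈ E | e ⊆ T}
      = ∑ G ∈ E.powerset, (∑ T with G.sup id ⊆ T, (-1) ^ #Tᶜ) * mobiusTransform f G := by
        simp only [expand, mul_sum, sum_mul, sum_filter, mul_ite, ite_mul, mul_zero, zero_mul]
        exact sum_comm
    _ = _ := by
        simp only [sum_neg_one_pow_card_compl_of_subset, ite_mul, one_mul, zero_mul, ← sum_filter]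

end Mobius

section Cluster

variable {n : ℕ} {ι : Type*} [DecidableEq ι]

/-- `M` is a clique of the graph whose edges are the two-element sets belonging to `H`. -/
def IsCliqueOf (H : Finset (Finset ι)) (M : Finset ι) : Prop := ∀ e ∈ M.powersetCard 2, e ∈ H

instance (H : Finset (Finset ι)) : DecidablePred (IsCliqueOf H) := fun M =>
  inferInstanceAs (Decidable (∀ e ∈ M.powersetCard 2, e ∈ H))

/-- The number of coordinates that are free in all the cubes of `M`, when the `j`-th element of the
multiset `s` is the set of the cubes in which the `j`-th coordinate is free. -/
def commonFreeCount (s : Multiset (Finset ι)) (M : Finset ι) : ℕ :=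
  s.countP fun F => ∀ i ∈ M, i ∈ F

theorem commonFreeCount_replicate_empty_add (c : ℕ) (s : Multiset (Finset ι)) {M : Finset ι}
    (hM : M.Nonempty) :
    commonFreeCount (Multiset.replicate c ∅ + s) M = commonFreeCount s M := by
  obtain ⟨i, hi⟩ := hM
  rw [commonFreeCount, Multiset.countP_add, commonFreeCount, Nat.add_eq_right,
    Multiset.countP_eq_zero]
  intro F hF h
  rw [Multiset.eq_of_mem_replicate hF] at h
  exact notMem_empty i (h i hi)

/-- In `s`, regarded as the incidence structure of a family of sets indexed by `ι`, every set has
`r` elements. -/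
def IsRegularOfDegree (r : ℕ) (s : Multiset (Finset ι)) : Prop := ∀ i, s.countP (i ∈ ·) = r

theorem isRegularOfDegree_replicate_empty_add {r c : ℕ} {s : Multiset (Finset ι)} :
    IsRegularOfDegree r (Multiset.replicate c ∅ + s) ↔ IsRegularOfDegree r s := by
  refine forall_congr' fun i => ?_
  rw [Multiset.countP_add, Multiset.countP_eq_zero.2, zero_add]
  intro F hF
  rw [Multiset.eq_of_mem_replicate hF]
  exact notMem_empty i

variable [Fintype ι]

instance (r : ℕ) : DecidablePred (IsRegularOfDegree (ι := ι) r) := fun s =>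
  inferInstanceAs (Decidable (∀ i, s.countP (i ∈ ·) = r))

/-- The overlap of a family of cubes whose coordinates are free as recorded by `s` (see
`commonFreeCount`) and which pairwise intersect exactly along the edges of `H`. -/
def cliqueOverlap (s : Multiset (Finset ι)) (H : Finset (Finset ι)) : ℤ :=
  ∑ M : Finset ι with 2 ≤ #M ∧ IsCliqueOf H M, (-1) ^ #M * 2 ^ commonFreeCount s M

/-- The number of ways to choose the values of a coordinate in cubes indexed by `ι`, those in `F`
having it free, so that no two cubes joined by an edge of `G` fix it to different values. Free
coordinates carry an irrelevant value as well. -/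
def columnCount (G : Finset (Finset ι)) (F : Finset ι) : ℕ :=
  #{v : ι → Bool | ∀ e ∈ G, ∀ i ∈ e \ F, ∀ i' ∈ e \ F, v i = v i'}

/-- The graphs on `ι`, as sets of edges. -/
def graphs (ι : Type*) [Fintype ι] : Finset (Finset (Finset ι)) :=
  (univ.powersetCard 2).powerset

/-- The graphs on `ι` that have no isolated vertices. -/
def spanningGraphs (ι : Type*) [DecidableEq ι] [Fintype ι] : Finset (Finset (Finset ι)) :=
  {G ∈ graphs ι | G.sup id = univ}

/-- The contribution of the graph `G` to the cluster expansion of the joint moment of the centered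
indicators of cubes whose free coordinates are recorded by `s`. The sum over `H` is a Möbius
transform, written with an index set independent of `G` so that the kernel evaluates the overlap of
each `H` only once. -/
def clusterTerm (G : Finset (Finset ι)) (s : Multiset (Finset ι)) : ℤ :=
  (s.map (columnCount G)).prod *
    ∑ H ∈ graphs ι with H ⊆ G, (-1) ^ (#G - #H) * 2 ^ (cliqueOverlap s H).toNat

theorem clusterTerm_eq_mul_mobiusTransform {G : Finset (Finset ι)} (hG : G ∈ graphs ι)
    (s : Multiset (Finset ι)) :
    clusterTerm G s = (s.map (columnCount G)).prod *
      mobiusTransform (fun H => 2 ^ (cliqueOverlap s H).toNat) G := by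
  have subgraphs_eq : {H ∈ graphs ι | H ⊆ G} = G.powerset := by
    ext H
    simp only [mem_filter, graphs, mem_powerset, and_iff_right_iff_imp]
    exact fun h => h.trans (mem_powerset.1 hG)
  rw [clusterTerm, subgraphs_eq, mobiusTransform]

/-- The family of sets with the incidence relation of `J` read from the other side: for the sets
`J i` of free coordinates of a family of cubes, the `j`-th set is the set of those cubes in which
the `j`-th coordinate is free. -/
def transpose {α β : Type*} [Fintype α] [DecidableEq β] (J : α → Finset β) (b : β) : Finset α :=
  {a | b ∈ J a}

/-- The multiset that records, for every coordinate, in which of the cubes with sets of free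
coordinates `J i` it is free. -/
def profile (J : ι → Finset (Fin n)) : Multiset (Finset ι) := univ.val.map (transpose J)

theorem isCliqueOf_filter_compatible {J : ι → Finset (Fin n)} {a : ι → Cube n} {M T : Finset ι}
    (hM : 2 ≤ #M) :
    IsCliqueOf {e ∈ {e ∈ univ.powersetCard 2 | IsCompatible J a e} | e ⊆ T} M ↔
      M ⊆ T ∧ IsCompatible J a M := by
  have subset_iff_pair : M ⊆ T ↔ ∀ e ∈ M.powersetCard 2, e ⊆ T := by
    refine ⟨fun h e he => (mem_powersetCard.1 he).1.trans h, fun h i hi => ?_⟩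
    obtain ⟨i', hi', hne⟩ := exists_mem_ne hM i
    exact h {i, i'} (mem_powersetCard.2 ⟨by grind, card_pair hne.symm⟩) (by simp)
  rw [subset_iff_pair, isCompatible_iff_forall_pair, ← forall₂_and]
  refine forall₂_congr fun e he => ?_
  simp only [mem_filter, mem_powersetCard_univ, (mem_powersetCard.1 he).2, true_and, and_comm]

theorem commonFreeCount_profile (J : ι → Finset (Fin n)) (M : Finset ι) :
    commonFreeCount (profile J) M = #{j | ∀ i ∈ M, j ∈ J i} := by
  simp only [commonFreeCount, profile, Multiset.countP_map, card_def, filter_val, transpose,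
    mem_filter_univ]

theorem overlap_subcube (J : ι → Finset (Fin n)) (a : ι → Cube n) (T : Finset ι) :
    overlap (fun i => subcube (J i) (a i)) T =
      (cliqueOverlap (profile J)
        {e ∈ {e ∈ univ.powersetCard 2 | IsCompatible J a e} | e ⊆ T}).toNat := by
  rw [← Int.toNat_natCast (overlap _ _), overlap_eq_sum_card_inf, cliqueOverlap]
  congr 1
  simp only [card_inf_subcube, Nat.cast_ite, Nat.cast_zero, mul_ite, mul_zero]
  rw [← sum_filter]
  refine sum_congr (ext fun M => ?_) fun M _ => ?_
  · simp only [mem_filter, mem_powerset, mem_univ, true_and]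
    by_cases hM : 2 ≤ #M
    · simp only [hM, isCliqueOf_filter_compatible hM, and_true, true_and]
    · simp only [hM, and_false, false_and]
  · rw [commonFreeCount_profile, Nat.cast_pow, Nat.cast_ofNat]

theorem card_forall_isCompatible (J : ι → Finset (Fin n)) (G : Finset (Finset ι)) :
    #{a : ι → Cube n | ∀ e ∈ G, IsCompatible J a e} = ((profile J).map (columnCount G)).prod := by
  have prod_eq : ((profile J).map (columnCount G)).prod =
      ∏ j, #{v : ι → Bool |
        ∀ e ∈ G, ∀ i ∈ e \ transpose J j, ∀ i' ∈ e \ transpose J j, v i = v i'} := by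
    rw [profile, Multiset.map_map]
    exact prod_congr rfl fun j _ => rfl
  rw [prod_eq, ← Fintype.card_piFinset]
  refine card_equiv (Equiv.piComm _) fun a => ?_
  simp only [mem_filter_univ, Fintype.mem_piFinset, IsCompatible, mem_sdiff, transpose]
  grind [Equiv.piComm_apply]

theorem sum_expect_prod_centeredIndicator_subcube (J : ι → Finset (Fin n)) :
    ∑ a : ι → Cube n, 𝔼 S, ∏ i, centeredIndicator (subcube (J i) (a i)) S =
      ((∑ G ∈ spanningGraphs ι, clusterTerm G (profile J) : ℤ) : ℝ) := by
  set f : Finset (Finset ι) → ℤ := fun H => 2 ^ (cliqueOverlap (profile J) H).toNat with hf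
  have graph_expansion (a : ι → Cube n) :
      𝔼 S, ∏ i, centeredIndicator (subcube (J i) (a i)) S =
        ((∑ G ∈ spanningGraphs ι,
          if ∀ e ∈ G, IsCompatible J a e then mobiusTransform f G else 0 : ℤ) : ℝ) := by
    rw [expect_prod_centeredIndicator, ← sum_filter, spanningGraphs, graphs, filter_filter]
    simp only [overlap_subcube]
    have := sum_neg_one_pow_card_compl_mul_filter_subset f
      {e ∈ univ.powersetCard 2 | IsCompatible J a e}
    rw [← Int.cast_inj (α := ℝ)] at this
    push_cast [hf] at this ⊢
    rw [this]
    refine sum_congr (ext fun G => ?_) fun _ _ => rfl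
    simp only [mem_filter, mem_powerset, subset_iff]
    grind
  simp only [graph_expansion, ← Int.cast_sum]
  rw [sum_comm]
  congr 1
  refine sum_congr rfl fun G hG => ?_
  rw [← sum_filter, sum_const, card_forall_isCompatible, nsmul_eq_mul,
    clusterTerm_eq_mul_mobiusTransform (mem_filter.1 hG).1]

theorem isRegularOfDegree_profile {r : ℕ} {J : ι → Finset (Fin n)} :
    IsRegularOfDegree r (profile J) ↔ ∀ i, #(J i) = r := by
  refine forall_congr' fun i => ?_
  simp only [profile, Multiset.countP_map, transpose, mem_filter_univ]
  rw [← filter_val, ← card_def, filter_univ_mem]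

theorem cliqueOverlap_replicate_empty_add (c : ℕ) (s : Multiset (Finset ι))
    (H : Finset (Finset ι)) :
    cliqueOverlap (Multiset.replicate c ∅ + s) H = cliqueOverlap s H := by
  refine sum_congr rfl fun M hM => ?_
  rw [commonFreeCount_replicate_empty_add]
  exact card_pos.1 (by grind)

theorem clusterTerm_replicate_empty_add (c : ℕ) (s : Multiset (Finset ι)) (G : Finset (Finset ι)) :
    clusterTerm G (Multiset.replicate c ∅ + s) = columnCount G ∅ ^ c * clusterTerm G s := by
  simp only [clusterTerm, cliqueOverlap_replicate_empty_add, Multiset.map_add, Multiset.prod_add,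
    Multiset.map_replicate, Multiset.prod_replicate]
  push_cast
  ring

theorem sum_countP_mem (s : Multiset (Finset ι)) :
    ∑ i, s.countP (i ∈ ·) = (s.map card).sum := by
  induction s using Multiset.induction_on with
  | empty => simp
  | cons F s ih =>
    simp only [Multiset.countP_cons, sum_add_distrib, ih, sum_boole, filter_univ_mem,
      Multiset.map_cons, Multiset.sum_cons, Nat.cast_id, add_comm]

theorem card_le_of_isRegularOfDegree {r : ℕ} {s : Multiset (Finset ι)} (h : IsRegularOfDegree r s)
    (hs : ∀ F ∈ s, F.Nonempty) : s.card ≤ Fintype.card ι * r :=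
  calc s.card ≤ (s.map card).sum := by
        simpa using Multiset.card_nsmul_le_sum (s := s.map card) (a := 1)
          (by simpa [Nat.one_le_iff_ne_zero, nonempty_iff_ne_empty] using hs)
    _ = ∑ i, s.countP (i ∈ ·) := (sum_countP_mem s).symm
    _ = Fintype.card ι * r := by simp [h _]

end Cluster

section Words

variable {A : Type*}

/-- The operator that turns a function of a multiset into the function of what remains after
adding the letter `a`; its powers express sums over words, whose letters are fed in one by one. -/
def consLetter (a : A) : Module.End ℤ (Multiset A → ℤ) := LinearMap.funLeft ℤ ℤ (a ::ₘ ·)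

theorem consLetter_pow_apply (a : A) (c : ℕ) (Φ : Multiset A → ℤ) (s : Multiset A) :
    (consLetter a ^ c) Φ s = Φ (Multiset.replicate c a + s) := by
  induction c generalizing s with
  | zero => simp
  | succ c ih =>
    rw [pow_succ', Module.End.mul_apply, consLetter, LinearMap.funLeft_apply, ← consLetter, ih,
      Multiset.replicate_succ, Multiset.cons_add, Multiset.add_cons]

theorem commute_consLetter (a b : A) : Commute (consLetter a) (consLetter b) :=
  LinearMap.ext fun Φ => funext fun s => congrArg Φ (Multiset.cons_swap b a s)

theorem sum_word_eq_pow_apply [Fintype A] (n : ℕ) (Φ : Multiset A → ℤ) (s : Multiset A) :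
    ∑ w : Fin n → A, Φ (univ.val.map w + s) = ((∑ a, consLetter a) ^ n) Φ s := by
  induction n generalizing s with
  | zero => simp
  | succ n ih =>
    rw [pow_succ', Module.End.mul_apply, LinearMap.sum_apply, Finset.sum_apply,
      ← (Fin.consEquiv fun _ => A).sum_comp, Fintype.sum_prod_type]
    refine sum_congr rfl fun a _ => ?_
    rw [consLetter, LinearMap.funLeft_apply, ← ih]
    refine sum_congr rfl fun w _ => congrArg Φ ?_
    simp [Fin.univ_succ, Fin.consEquiv, -Multiset.cons_coe]

/-- The sum of the operators `consLetter a` over the letters `a` of a list. -/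
def consLetters (L : List A) : Module.End ℤ (Multiset A → ℤ) := (L.map consLetter).sum

theorem consLetters_apply (L : List A) (Φ : Multiset A → ℤ) (s : Multiset A) :
    consLetters L Φ s = (L.map fun a => Φ (a ::ₘ s)).sum := by
  induction L with
  | nil => rfl
  | cons a L ih =>
    rw [List.map_cons, List.sum_cons, ← ih]
    rfl

theorem consLetters_eq_sum [Fintype A] {L : List A} (hL : ∀ a, a ∈ L)
    (nodup : L.Nodup) : consLetters L = ∑ a, consLetter a := by
  classical
  rw [consLetters, ← List.sum_toFinset _ nodup,
    eq_univ_of_forall fun a => List.mem_toFinset.2 (hL a)]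

theorem commute_consLetter_consLetters (a : A) (L : List A) :
    Commute (consLetter a) (consLetters L) :=
  Commute.list_sum_right _ _ (by simp [commute_consLetter])

theorem consLetters_cons_pow_apply (a : A) (L : List A) (n : ℕ) (Φ : Multiset A → ℤ)
    (s : Multiset A) :
    (consLetters (a :: L) ^ n) Φ s =
      ∑ c ∈ range (n + 1),
        (n.choose c : ℤ) * (consLetters L ^ (n - c)) Φ (Multiset.replicate c a + s) := by
  rw [consLetters, List.map_cons, List.sum_cons, ← consLetters,
    (commute_consLetter_consLetters a L).add_pow, LinearMap.sum_apply, Finset.sum_apply]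
  refine sum_congr rfl fun c _ => ?_
  rw [← Nat.cast_comm, Module.End.mul_apply, Module.End.mul_apply, Module.End.natCast_apply,
    Pi.smul_apply, consLetter_pow_apply, nsmul_eq_mul]

theorem consLetters_pow_apply_eq_zero {L : List A} {n : ℕ} {Φ : Multiset A → ℤ} {s : Multiset A}
    (h : ∀ t : Multiset A, t.card = n → (∀ a ∈ t, a ∈ L) → Φ (t + s) = 0) :
    (consLetters L ^ n) Φ s = 0 := by
  induction n generalizing s with
  | zero => simpa using h 0 rfl (by simp)
  | succ n ih =>
    rw [pow_succ', Module.End.mul_apply, consLetters_apply]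
    refine List.sum_eq_zero fun z hz => ?_
    obtain ⟨a, ha, rfl⟩ := List.mem_map.1 hz
    refine ih fun t ht htL => ?_
    rw [Multiset.add_cons, ← Multiset.cons_add]
    exact h _ (by rw [Multiset.card_cons, ht]) (Multiset.forall_mem_cons.2 ⟨ha, htL⟩)

/-- The sum of `Φ (t + s)` over the words of length `n` in the letters of `L`, `t` being the
multiset of the letters of the word, computed letter by letter: the `c`-fold occurrences of the
first letter are placed in `n.choose c` ways. Branches in which `viable` fails are cut off. -/
def letterSum (viable : List A → Multiset A → Prop) [∀ L, DecidablePred (viable L)]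
    (Φ : Multiset A → ℤ) : List A → ℕ → Multiset A → ℤ
  | [], n, s => if n = 0 then Φ s else 0
  | a :: L, n, s => ∑ c ∈ range (n + 1),
      if viable L (Multiset.replicate c a + s) then
        (n.choose c : ℤ) * letterSum viable Φ L (n - c) (Multiset.replicate c a + s)
      else 0

theorem letterSum_eq_pow_apply {viable : List A → Multiset A → Prop}
    [∀ L, DecidablePred (viable L)] {Φ : Multiset A → ℤ}
    (hΦ : ∀ L s t, ¬ viable L s → (∀ a ∈ t, a ∈ L) → Φ (t + s) = 0) (L : List A) (n : ℕ)
    (s : Multiset A) :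
    letterSum viable Φ L n s = (consLetters L ^ n) Φ s := by
  induction L generalizing n s with
  | nil => cases n <;> simp [letterSum, consLetters]
  | cons a L ih =>
    rw [letterSum, consLetters_cons_pow_apply]
    refine sum_congr rfl fun c _ => ?_
    split_ifs with h
    · rw [ih]
    · rw [consLetters_pow_apply_eq_zero fun t _ ht => hΦ L _ t h ht, mul_zero]

end Words

section Profile

variable {n r B : ℕ} {ι : Type*} [DecidableEq ι] [Fintype ι] {L : List (Finset ι)}

/-- No `i` belongs to more than `r` members of `s`, and those that belong to fewer can still be
supplied by the letters in `L`. -/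
def IsViable (r : ℕ) (L : List (Finset ι)) (s : Multiset (Finset ι)) : Prop :=
  ∀ i, s.countP (i ∈ ·) = r ∨ s.countP (i ∈ ·) < r ∧ L.any (i ∈ ·)

instance (r : ℕ) (L : List (Finset ι)) : DecidablePred (IsViable r L) := fun s =>
  inferInstanceAs (Decidable (∀ i, s.countP (i ∈ ·) = r ∨ s.countP (i ∈ ·) < r ∧ L.any (i ∈ ·)))

/-- The sum of the cluster terms at `s` of the graphs without isolated vertices that have `B`
two-colorings constant on components, provided that every cube has dimension `r`. -/
def regularClusterSum (r B : ℕ) (s : Multiset (Finset ι)) : ℤ :=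
  if IsRegularOfDegree r s then
    ∑ G ∈ spanningGraphs ι with columnCount G ∅ = B, clusterTerm G s
  else 0

theorem regularClusterSum_eq_zero_of_not_isViable {s t : Multiset (Finset ι)}
    (hs : ¬ IsViable r L s) (ht : ∀ F ∈ t, F ∈ L) : regularClusterSum r B (t + s) = 0 := by
  refine if_neg fun h => hs fun i => ?_
  have count_add := h i
  rw [Multiset.countP_add] at count_add
  rcases Nat.eq_zero_or_pos (t.countP (i ∈ ·)) with h0 | hpos
  · exact .inl (by omega)
  · obtain ⟨F, hF, hi⟩ := Multiset.countP_pos.1 hpos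
    exact .inr ⟨by omega, List.any_eq_true.2 ⟨F, ht F hF, decide_eq_true hi⟩⟩

theorem consLetter_empty_pow_regularClusterSum (c : ℕ) :
    (consLetter ∅ ^ c) (regularClusterSum r B) =
      ((B : ℤ) ^ c) • regularClusterSum (ι := ι) r B := by
  ext s
  simp only [consLetter_pow_apply, regularClusterSum, isRegularOfDegree_replicate_empty_add,
    clusterTerm_replicate_empty_add, Pi.smul_apply, smul_eq_mul, mul_ite, mul_sum, mul_zero]
  congr 1
  exact sum_congr rfl fun G hG => by rw [(mem_filter.1 hG).2]

/-- The coefficient of `B ^ (n - m) * n.choose m` in the sum of the cluster terms: it sums over the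
words of length `m`, recording the coordinates that are free in at least one cube. The list `L`
contains the letters, that is, the nonempty subsets of `ι`. -/
def clusterCoeff (r B : ℕ) (L : List (Finset ι)) (m : ℕ) : ℤ :=
  letterSum (IsViable r) (regularClusterSum r B) L m 0

theorem clusterCoeff_eq_pow_apply (m : ℕ) :
    clusterCoeff r B L m = (consLetters L ^ m) (regularClusterSum r B) 0 :=
  letterSum_eq_pow_apply (fun _ _ _ => regularClusterSum_eq_zero_of_not_isViable) L m 0

theorem clusterCoeff_eq_zero {m : ℕ} (hL : ∀ F ∈ L, F.Nonempty) (hm : Fintype.card ι * r < m) :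
    clusterCoeff r B L m = 0 := by
  rw [clusterCoeff_eq_pow_apply]
  refine consLetters_pow_apply_eq_zero fun t ht htL => if_neg fun h => ?_
  rw [add_zero] at h
  exact hm.not_ge (ht ▸ card_le_of_isRegularOfDegree h fun F hF => hL F (htL F hF))

theorem sum_regularClusterSum_word (hL : ∀ F, F ∈ L ↔ F.Nonempty) (nodup : L.Nodup) :
    ∑ w : Fin n → Finset ι, regularClusterSum r B (univ.val.map w) =
      ∑ m ∈ range (Fintype.card ι * r + 1),
        n.choose m * (B ^ (n - m) * clusterCoeff r B L m) := by
  have letters : consLetters (∅ :: L) = ∑ F, consLetter F :=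
    consLetters_eq_sum (fun F => by simpa [hL] using F.eq_empty_or_nonempty)
      (List.nodup_cons.2 ⟨by simp [hL], nodup⟩)
  calc ∑ w : Fin n → Finset ι, regularClusterSum r B (univ.val.map w)
      = (consLetters (∅ :: L) ^ n) (regularClusterSum r B) 0 := by
        simp only [letters, ← sum_word_eq_pow_apply, add_zero]
    _ = ∑ c ∈ range (n + 1), n.choose c * (B ^ c * clusterCoeff r B L (n - c)) := by
        rw [consLetters_cons_pow_apply]
        refine sum_congr rfl fun c _ => ?_
        rw [← consLetter_pow_apply ∅ c ((consLetters L ^ (n - c)) (regularClusterSum r B)),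
          ← Module.End.mul_apply, ((commute_consLetter_consLetters ∅ L).pow_pow c (n - c)).eq,
          Module.End.mul_apply, consLetter_empty_pow_regularClusterSum, map_smul, Pi.smul_apply,
          smul_eq_mul, clusterCoeff_eq_pow_apply]
    _ = ∑ m ∈ range (n + 1), n.choose m * (B ^ (n - m) * clusterCoeff r B L m) := by
        rw [← sum_flip]
        refine sum_congr rfl fun m hm => ?_
        have hmn : m ≤ n := Nat.lt_succ_iff.1 (mem_range.1 hm)
        rw [Nat.choose_symm hmn, Nat.sub_sub_self hmn]
    _ = _ := by
        refine sum_congr_of_eq_on_inter (fun m _ hm => ?_) (fun m _ hm => ?_) fun _ _ _ => rfl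
        · rw [clusterCoeff_eq_zero (fun F => (hL F).1) (by simpa using hm), mul_zero, mul_zero]
        · rw [Nat.choose_eq_zero_of_lt (by simpa using hm), Nat.cast_zero, zero_mul]

theorem transpose_transpose {α β : Type*} [Fintype α] [DecidableEq α] [Fintype β] [DecidableEq β]
    (J : α → Finset β) : transpose (transpose J) = J := by
  ext a b
  simp only [transpose, mem_filter_univ]

theorem sum_clusterTerm_profile {values : Finset ℕ} (hL : ∀ F, F ∈ L ↔ F.Nonempty)
    (nodup : L.Nodup) (hvalues : ∀ G ∈ spanningGraphs ι, columnCount G ∅ ∈ values) :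
    ∑ J ∈ Fintype.piFinset fun _ : ι => powersetCard r (univ : Finset (Fin n)),
        ∑ G ∈ spanningGraphs ι, clusterTerm G (profile J) =
      ∑ m ∈ range (Fintype.card ι * r + 1),
        n.choose m * ∑ B ∈ values, B ^ (n - m) * clusterCoeff r B L m := by
  have mem_regular {J : ι → Finset (Fin n)} :
      (J ∈ Fintype.piFinset fun _ => powersetCard r univ) ↔ ∀ i, #(J i) = r := by
    simp only [Fintype.mem_piFinset, mem_powersetCard_univ]
  calc _ = ∑ J : ι → Finset (Fin n), ∑ B ∈ values, regularClusterSum r B (profile J) := by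
        refine sum_subset_zero_on_sdiff (subset_univ _) (fun J hJ => ?_) fun J hJ => ?_
        · exact sum_eq_zero fun B _ =>
            if_neg fun h => (mem_sdiff.1 hJ).2 (mem_regular.2 (isRegularOfDegree_profile.1 h))
        · simp only [regularClusterSum, if_pos (isRegularOfDegree_profile.2 (mem_regular.1 hJ))]
          exact (sum_fiberwise_of_maps_to hvalues _).symm
    _ = ∑ w : Fin n → Finset ι, ∑ B ∈ values, regularClusterSum r B (univ.val.map w) :=
        sum_nbij' transpose transpose (by simp) (by simp) (fun _ _ => transpose_transpose _)
          (fun _ _ => transpose_transpose _) fun _ _ => rfl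
    _ = _ := by
        rw [sum_comm]
        simp only [sum_regularClusterSum_word hL nodup, mul_sum]
        exact sum_comm

end Profile

section Moment

variable {n : ℕ}

theorem mem_subcube_self (J : Finset (Fin n)) (a : Cube n) : a ∈ subcube J a :=
  mem_subcube.2 fun _ _ => rfl

theorem subcube_eq_of_mem {J : Finset (Fin n)} {a b : Cube n} (h : b ∈ subcube J a) :
    subcube J b = subcube J a := by
  ext x
  simp only [mem_subcube]
  exact forall₂_congr fun j hj => by rw [mem_subcube.1 h j hj]

theorem subset_of_subcube_subset {J J' : Finset (Fin n)} {a a' : Cube n}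
    (h : subcube J a ⊆ subcube J' a') : J ⊆ J' := by
  intro j hj
  by_contra hj'
  have flip_mem : Function.update a j (!a j) ∈ subcube J a :=
    mem_subcube.2 fun i hi => Function.update_of_ne (ne_of_mem_of_not_mem hj hi).symm _ _
  have flip_eq := mem_subcube.1 (h flip_mem) j hj'
  rw [Function.update_self, ← mem_subcube.1 (h (mem_subcube_self J a)) j hj'] at flip_eq
  exact Bool.not_ne_self _ flip_eq

theorem subcube_eq_subcube_iff {J J' : Finset (Fin n)} {a a' : Cube n} :
    subcube J a = subcube J' a' ↔ J = J' ∧ a ∈ subcube J' a' := by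
  refine ⟨fun h => ⟨?_, h ▸ mem_subcube_self J a⟩, ?_⟩
  · exact (subset_of_subcube_subset h.subset).antisymm (subset_of_subcube_subset h.symm.subset)
  · rintro ⟨rfl, ha⟩
    exact subcube_eq_of_mem ha

theorem mem_subcubes {r : ℕ} {C : Finset (Cube n)} :
    C ∈ subcubes n r ↔ ∃ (J : Finset (Fin n)) (a : Cube n), #J = r ∧ C = subcube J a :=
  mem_filter_univ _

theorem sum_subcube_eq_two_pow_mul_sum_subcubes (r : ℕ) (f : Finset (Cube n) → ℝ) :
    ∑ J ∈ powersetCard r (univ : Finset (Fin n)), ∑ a, f (subcube J a) =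
      2 ^ r * ∑ C ∈ subcubes n r, f C := by
  have maps_to : ∀ p ∈ powersetCard r univ ×ˢ (univ : Finset (Cube n)),
      subcube p.1 p.2 ∈ subcubes n r :=
    fun p hp => mem_subcubes.2 ⟨p.1, p.2, mem_powersetCard_univ.1 (mem_product.1 hp).1, rfl⟩
  have card_fiber : ∀ C ∈ subcubes n r,
      #{p ∈ powersetCard r univ ×ˢ (univ : Finset (Cube n)) | subcube p.1 p.2 = C} = 2 ^ r := by
    intro C hC
    obtain ⟨J, a, rfl, rfl⟩ := mem_subcubes.1 hC
    have fiber_eq : {p ∈ powersetCard #J (univ : Finset (Fin n)) ×ˢ (univ : Finset (Cube n)) |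
        subcube p.1 p.2 = subcube J a} = {J} ×ˢ subcube J a := by
      ext ⟨J', b⟩
      simp only [mem_filter, mem_product, mem_powersetCard_univ, mem_univ, and_true, mem_singleton,
        subcube_eq_subcube_iff, and_iff_right_iff_imp]
      exact fun h => congrArg card h.1
    rw [fiber_eq, card_product, card_singleton, one_mul, card_subcube]
  rw [← sum_product', ← sum_fiberwise_of_maps_to' maps_to, mul_sum]
  refine sum_congr rfl fun C hC => ?_
  rw [sum_const, card_fiber C hC, nsmul_eq_mul, Nat.cast_pow, Nat.cast_ofNat]

theorem card_of_mem_subcubes {r : ℕ} {C : Finset (Cube n)} (hC : C ∈ subcubes n r) :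
    #C = 2 ^ r := by
  obtain ⟨J, a, rfl, rfl⟩ := mem_subcubes.1 hC
  exact card_subcube J a

theorem subcubeCount_sub_expect (r : ℕ) (S : Finset (Cube n)) :
    (subcubeCount n r S : ℝ) - 𝔼 S', (subcubeCount n r S' : ℝ) =
      (∑ J ∈ powersetCard r (univ : Finset (Fin n)), ∑ a, centeredIndicator (subcube J a) S) /
        2 ^ (2 ^ r + r) := by
  have count_eq (S : Finset (Cube n)) :
      (subcubeCount n r S : ℝ) = ∑ C ∈ subcubes n r, if C ⊆ S then 1 else 0 := by
    rw [subcubeCount, sum_boole]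
  simp only [count_eq]
  rw [expect_sum_comm, ← sum_sub_distrib,
    sum_subcube_eq_two_pow_mul_sum_subcubes r fun C => centeredIndicator C S, pow_add, mul_comm,
    mul_div_mul_right _ _ (by positivity), sum_div]
  refine sum_congr rfl fun C hC => ?_
  rw [expect_indicator_subset, centeredIndicator, card_of_mem_subcubes hC]
  field_simp

theorem sum_sum_pow_eq_sum_piFinset {α β R : Type*} [Fintype β] [CommSemiring R]
    (s : Finset α) (f : α → β → R) (k : ℕ) :
    (∑ x ∈ s, ∑ y, f x y) ^ k =
      ∑ x ∈ Fintype.piFinset fun _ : Fin k => s, ∑ y : Fin k → β, ∏ i, f (x i) (y i) := by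
  rw [← Fin.prod_const, prod_univ_sum]
  refine sum_congr rfl fun x _ => ?_
  rw [prod_univ_sum, Fintype.piFinset_univ]

theorem cast_choose_succ (n m : ℕ) :
    (n.choose (m + 1) : ℝ) = n.choose m * (n - m) / (m + 1) := by
  rw [eq_div_iff (by positivity)]
  obtain hmn | hnm := le_or_gt m n
  · rw [← Nat.cast_sub hmn]
    exact_mod_cast Nat.choose_succ_right_eq n m
  · simp only [Nat.choose_eq_zero_of_lt hnm, Nat.choose_eq_zero_of_lt (Nat.lt_succ_of_lt hnm),
      Nat.cast_zero, zero_mul]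

theorem choose_mul_pow_sub {K : Type*} [Field K] {x : K} (hx : x ≠ 0) (n m : ℕ) :
    n.choose m * x ^ (n - m) = x ^ n * (n.choose m / x ^ m) := by
  obtain hmn | hnm := le_or_gt m n
  · rw [pow_sub₀ x hx hmn]
    ring
  · simp only [Nat.choose_eq_zero_of_lt hnm, Nat.cast_zero, zero_mul, zero_div, mul_zero]

theorem subcubeCentralMoment_eq_sum_clusterCoeff (n r k : ℕ) {L : List (Finset (Fin k))}
    {values : Finset ℕ} (hL : ∀ F, F ∈ L ↔ F.Nonempty) (nodup : L.Nodup)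
    (hvalues : ∀ G ∈ spanningGraphs (Fin k), columnCount G ∅ ∈ values)
    (values_ne_zero : ∀ B ∈ values, B ≠ 0) :
    subcubeCentralMoment n r k =
      (∑ B ∈ values, (B : ℝ) ^ n *
        ∑ m ∈ range (k * r + 1), n.choose m / (B : ℝ) ^ m * clusterCoeff r B L m) /
          2 ^ (k * (2 ^ r + r)) := by
  have expansion := sum_clusterTerm_profile (n := n) (r := r) hL nodup hvalues
  rw [Fintype.card_fin] at expansion
  have factor_pow : ((∑ m ∈ range (k * r + 1),
      n.choose m * ∑ B ∈ values, B ^ (n - m) * clusterCoeff r B L m : ℤ) : ℝ) =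
        ∑ B ∈ values, (B : ℝ) ^ n *
          ∑ m ∈ range (k * r + 1), n.choose m / (B : ℝ) ^ m * clusterCoeff r B L m := by
    push_cast
    simp only [mul_sum]
    rw [sum_comm]
    refine sum_congr rfl fun B hB => sum_congr rfl fun m _ => ?_
    rw [← mul_assoc, choose_mul_pow_sub (Nat.cast_ne_zero.2 (values_ne_zero B hB)), mul_assoc]
  rw [subcubeCentralMoment, uniformSubset, centralMoment_uniformOn_univ, ← factor_pow, ← expansion]
  simp only [subcubeCount_sub_expect, div_pow, ← pow_mul, mul_comm (_ + r) k]
  rw [← expect_div]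
  congr 1
  simp only [sum_sum_pow_eq_sum_piFinset, expect_sum_comm,
    sum_expect_prod_centeredIndicator_subcube, Int.cast_sum]

end Moment

section Evaluation

/-- The nonempty subsets of a three-element index set, the letters of a word for third moments. -/
def letters₃ : List (Finset (Fin 3)) := [{0, 1, 2}, {0, 1}, {0, 2}, {1, 2}, {0}, {1}, {2}]

/-- The nonempty subsets of a four-element index set, the letters of a word for fourth moments. -/
def letters₄ : List (Finset (Fin 4)) :=
  [{0, 1, 2, 3}, {0, 1, 2}, {0, 1, 3}, {0, 2, 3}, {1, 2, 3}, {0, 1}, {0, 2}, {0, 3}, {1, 2}, {1, 3},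
    {2, 3}, {0}, {1}, {2}, {3}]

theorem mem_letters₃ : ∀ F, F ∈ letters₃ ↔ F.Nonempty := by decide +kernel

theorem mem_letters₄ : ∀ F, F ∈ letters₄ ↔ F.Nonempty := by decide +kernel

theorem nodup_letters₃ : letters₃.Nodup := by decide +kernel

theorem nodup_letters₄ : letters₄.Nodup := by decide +kernel

theorem columnCount_empty_of_mem_spanningGraphs_three :
    ∀ G ∈ spanningGraphs (Fin 3), columnCount G ∅ ∈ ({2} : Finset ℕ) := by
  decide +kernel

theorem columnCount_empty_of_mem_spanningGraphs_four :
    ∀ G ∈ spanningGraphs (Fin 4), columnCount G ∅ ∈ ({2, 4} : Finset ℕ) := by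
  decide +kernel

theorem clusterCoeff_two_letters₃ : ∀ m < 7, clusterCoeff 2 2 letters₃ m =
    [0, 0, 13440, 302592, 1751040, 4055040, 3317760].getD m 0 := by
  decide +kernel

theorem clusterCoeff_three_letters₃ : ∀ m < 10, clusterCoeff 3 2 letters₃ m =
    [0, 0, 0, 33162240, 393633792, 2058485760, 6889144320, 14677770240, 17836277760,
      9248440320].getD m 0 := by
  decide +kernel

theorem clusterCoeff_two_letters₄_connected : ∀ m < 9, clusterCoeff 2 2 letters₄ m =
    [0, 0, 637440, 72677376, 1156374528, 7482900480, 23628349440, 36168007680,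
      21469593600].getD m 0 := by
  decide +kernel

theorem clusterCoeff_two_letters₄_matching : ∀ m < 9, clusterCoeff 2 4 letters₄ m =
    [0, 0, 172800, 18081792, 512040960, 6263930880, 37795921920, 110981283840,
      126835752960].getD m 0 := by
  decide +kernel

theorem sum_clusterCoeff_two_letters₃ (n : ℕ) :
    ∑ m ∈ range 7, n.choose m / (2 : ℝ) ^ m * clusterCoeff 2 2 letters₃ m =
      n * (n - 1) * (8 * (9 * n ^ 4 + 6 * n ^ 3 + 21 * n ^ 2 - 16 * n - 34)) := by
  rw [sum_congr rfl fun m hm => by rw [clusterCoeff_two_letters₃ m (mem_range.1 hm)]]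
  simp only [sum_range_succ, range_zero, sum_empty, cast_choose_succ, Nat.choose_zero_right,
    List.getD_cons_zero, List.getD_cons_succ]
  push_cast
  ring

theorem sum_clusterCoeff_three_letters₃ (n : ℕ) :
    ∑ m ∈ range 10, n.choose m / (2 : ℝ) ^ m * clusterCoeff 3 2 letters₃ m =
      n * (n - 1) * (n - 2) * (32 / 9 * (14 * n ^ 6 + 24 * n ^ 5 + 479 * n ^ 4 + 2046 * n ^ 3 +
        6779 * n ^ 2 + 15444 * n - 23112)) := by
  rw [sum_congr rfl fun m hm => by rw [clusterCoeff_three_letters₃ m (mem_range.1 hm)]]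
  simp only [sum_range_succ, range_zero, sum_empty, cast_choose_succ, Nat.choose_zero_right,
    List.getD_cons_zero, List.getD_cons_succ]
  push_cast
  ring

theorem sum_clusterCoeff_two_letters₄_connected (n : ℕ) :
    ∑ m ∈ range 9, n.choose m / (2 : ℝ) ^ m * clusterCoeff 2 2 letters₄ m =
      n * (n - 1) * (4 * (520 * n ^ 6 - 24 * n ^ 5 + 1272 * n ^ 4 - 840 * n ^ 3 - 5232 * n ^ 2 -
        2768 * n + 240)) := by
  rw [sum_congr rfl fun m hm => by rw [clusterCoeff_two_letters₄_connected m (mem_range.1 hm)]]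
  simp only [sum_range_succ, range_zero, sum_empty, cast_choose_succ, Nat.choose_zero_right,
    List.getD_cons_zero, List.getD_cons_succ]
  push_cast
  ring

theorem sum_clusterCoeff_two_letters₄_matching (n : ℕ) :
    ∑ m ∈ range 9, n.choose m / (4 : ℝ) ^ m * clusterCoeff 2 4 letters₄ m =
      n * (n - 1) * (4 * (12 * n ^ 6 + 12 * n ^ 5 + 24 * n ^ 4 - 12 * n ^ 3 - 9 * n ^ 2 -
        27 * n)) := by
  rw [sum_congr rfl fun m hm => by rw [clusterCoeff_two_letters₄_matching m (mem_range.1 hm)]]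
  simp only [sum_range_succ, range_zero, sum_empty, cast_choose_succ, Nat.choose_zero_right,
    List.getD_cons_zero, List.getD_cons_succ]
  push_cast
  ring

theorem subcubeCentralMoment_three (n r : ℕ) :
    subcubeCentralMoment n r 3 =
      2 ^ n * (∑ m ∈ range (3 * r + 1), n.choose m / (2 : ℝ) ^ m * clusterCoeff r 2 letters₃ m) /
        2 ^ (3 * (2 ^ r + r)) := by
  rw [subcubeCentralMoment_eq_sum_clusterCoeff n r 3 mem_letters₃ nodup_letters₃
    columnCount_empty_of_mem_spanningGraphs_three (by decide), sum_singleton, Nat.cast_ofNat]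

theorem subcubeCentralMoment_four (n r : ℕ) :
    subcubeCentralMoment n r 4 =
      (2 ^ n * (∑ m ∈ range (4 * r + 1), n.choose m / (2 : ℝ) ^ m * clusterCoeff r 2 letters₄ m) +
        4 ^ n * ∑ m ∈ range (4 * r + 1), n.choose m / (4 : ℝ) ^ m * clusterCoeff r 4 letters₄ m) /
          2 ^ (4 * (2 ^ r + r)) := by
  rw [subcubeCentralMoment_eq_sum_clusterCoeff n r 4 mem_letters₄ nodup_letters₄
    columnCount_empty_of_mem_spanningGraphs_four (by decide), sum_pair (by decide),
    Nat.cast_ofNat, Nat.cast_ofNat]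

end Evaluation

theorem mainTheorem4 (n : ℕ) :
    subcubeCentralMoment n 2 3 =
      (2 : ℝ) ^ n * (n : ℝ) * ((n : ℝ) - 1) / 32768 *
        (9 * (n : ℝ) ^ 4 + 6 * (n : ℝ) ^ 3 + 21 * (n : ℝ) ^ 2 - 16 * (n : ℝ) - 34) ∧
    subcubeCentralMoment n 2 4 =
      (2 : ℝ) ^ n * (n : ℝ) * ((n : ℝ) - 1) / 4194304 *
        (12 * (n : ℝ) ^ 6 * (2 : ℝ) ^ n + 12 * (n : ℝ) ^ 5 * (2 : ℝ) ^ n + 520 * (n : ℝ) ^ 6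
          + 24 * (n : ℝ) ^ 4 * (2 : ℝ) ^ n - 24 * (n : ℝ) ^ 5 - 12 * (n : ℝ) ^ 3 * (2 : ℝ) ^ n
          + 1272 * (n : ℝ) ^ 4 - 9 * (n : ℝ) ^ 2 * (2 : ℝ) ^ n - 840 * (n : ℝ) ^ 3
          - 27 * (n : ℝ) * (2 : ℝ) ^ n - 5232 * (n : ℝ) ^ 2 - 2768 * (n : ℝ) + 240) ∧
    subcubeCentralMoment n 3 3 =
      (2 : ℝ) ^ n * (n : ℝ) * ((n : ℝ) - 1) * ((n : ℝ) - 2) / 2415919104 *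
        (14 * (n : ℝ) ^ 6 + 24 * (n : ℝ) ^ 5 + 479 * (n : ℝ) ^ 4 + 2046 * (n : ℝ) ^ 3
          + 6779 * (n : ℝ) ^ 2 + 15444 * (n : ℝ) - 23112) := by
  have four_pow : (4 : ℝ) ^ n = 2 ^ n * 2 ^ n := by rw [← mul_pow]; norm_num
  refine ⟨?_, ?_, ?_⟩
  · rw [subcubeCentralMoment_three, sum_clusterCoeff_two_letters₃]
    ring
  · rw [subcubeCentralMoment_four, sum_clusterCoeff_two_letters₄_connected,
      sum_clusterCoeff_two_letters₄_matching, four_pow]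
    ring
  · rw [subcubeCentralMoment_three, sum_clusterCoeff_three_letters₃]
    ring
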